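/- A class $\mathsf K$ of commutative monoids $\langle A;\cdot,1\rangle$ is a \emph{variety} when it is closed under homomorphic images, subalgebras (submonoids) and direct products; $\mathsf{CM}$ is the variety of all commutative monoids, and a variety is a \emph{proper} subvariety of $\mathsf{CM}$ when it differs from $\mathsf{CM}$. A variety $\mathsf K$ of commutative monoids is \emph{inverse} when in each $A\in\mathsf K$ for every $a\in A$ there is a unique $b\in A$ with $a=aba$ and $b=bab$. A homomorphism $f\colon A\to B$ with $A,B\in\mathsf K$ is a \emph{$\mathsf K$-epimorphism} when for all homomorphisms $g,h\colon B\to C$ with $C\in\mathsf K$, $g\circ f=h\circ f$ implies $g=h$. We say that $\mathsf K$ has (i) the \emph{epimorphism surjectivity property} when all $\mathsf K$-epimorphisms are surjective; (ii) the \emph{weak epimorphism surjectivity property} when all $\mathsf K$-epimorphisms between finitely generated members of $\mathsf K$ are surjective; (iii) the \emph{strong epimorphism surjectivity property} when for every homomorphism $f\colon A\to B$ with $A,B\in\mathsf K$ and every $b\in B\setminus f[A]$ there are homomorphisms $g,h\colon B\to C$ with $C\in\mathsf K$ that agree on $f[A]$ and satisfy $g(b)\neq h(b)$. Then: (1) a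 variety of commutative monoids has the epimorphism surjectivity property if and only if it is inverse, and it has the strong epimorphism surjectivity property if and only if it is inverse; (2) every proper subvariety of $\mathsf{CM}$ has the weak epimorphism surjectivity property; (3) $\mathsf{CM}$ does not have the weak epimorphism surjectivity property. -/

import Mathlib

universe u

namespace CommMonVariety

/-- A class of commutative monoids is a variety when it is closed under
homomorphic images, subalgebras and direct products. -/
structure IsVariety (K : Set CommMonCat.{u}) : Prop where
  homImage : ∀ A B : CommMonCat.{u}, A ∈ K →
    ∀ f : A →* B, Function.Surjective f → B ∈ K
  subalgebra : ∀ A : CommMonCat.{u}, A ∈ K →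
    ∀ S : Submonoid A, CommMonCat.of S ∈ K
  product : ∀ (ι : Type u) (A : ι → CommMonCat.{u}), (∀ i, A i ∈ K) →
    CommMonCat.of (∀ i, A i) ∈ K

/-- The class of all commutative monoids. -/
def CM : Set CommMonCat.{u} := Set.univ

/-- A monoid is inverse when every element `a` has a unique `b` with
`a = a * b * a` and `b = b * a * b`. -/
def IsInverseMonoid (A : Type u) [Monoid A] : Prop :=
  ∀ a : A, ∃! b : A, a = a * b * a ∧ b = b * a * b

/-- A class of commutative monoids is inverse when so are its members. -/
def IsInverse (K : Set CommMonCat.{u}) : Prop :=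
  ∀ A ∈ K, IsInverseMonoid A

/-- The homomorphism `f` (between members of `K`) is a `K`-epimorphism. -/
def IsEpimorphism (K : Set CommMonCat.{u}) {A B : CommMonCat.{u}} (f : A →* B) : Prop :=
  ∀ C ∈ K, ∀ g h : B →* C, g.comp f = h.comp f → g = h

/-- The epimorphism surjectivity property: all `K`-epimorphisms are surjective. -/
def HasES (K : Set CommMonCat.{u}) : Prop :=
  ∀ A ∈ K, ∀ B ∈ K, ∀ f : A →* B, IsEpimorphism K f → Function.Surjective f

/-- The weak epimorphism surjectivity property: all `K`-epimorphisms between finitely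
generated algebras are surjective. -/
def HasWeakES (K : Set CommMonCat.{u}) : Prop :=
  ∀ A ∈ K, ∀ B ∈ K, Monoid.FG A → Monoid.FG B →
    ∀ f : A →* B, IsEpimorphism K f → Function.Surjective f

/-- The strong epimorphism surjectivity property: every `b` outside the range of a homomorphism
`f` of `K` is separated by two homomorphisms of `K` that agree on the range of `f`. -/
def HasStrongES (K : Set CommMonCat.{u}) : Prop :=
  ∀ A ∈ K, ∀ B ∈ K, ∀ f : A →* B, ∀ b : B, b ∉ Set.range f →
    ∃ C ∈ K, ∃ g h : B →* C, Set.EqOn g h (Set.range f) ∧ g b ≠ h b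

end CommMonVariety

/-!
All three parts reduce to the dominion of a submonoid `A` in a commutative monoid `B` of the
variety. The coproduct of two copies of `B` is `B × B`, so the amalgam of two copies of `B` over
`A` is a quotient of `B × B` and stays in the variety. Concretely, a predicate `P` on `B × B` that
does not see whether a factor from `A` sits on the left or on the right yields, through its
syntactic congruence, two homomorphisms out of `B` that agree on `A` and separate every `d` with
`P 1 d` and not `P d 1` (`IsVariety.exists_separating`).

* If `A` is inverse, the predicate "`d = a * y` and `a = e * x` for some `a, e ∈ A` with `e`
  idempotent" separates every `d ∉ A`, so inverse varieties have strong epimorphism surjectivity.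

* If `B` is finite and `d` is a minimal element of the complement of `A` for divisibility, let
  `e` be the least idempotent of `A` that fixes `d`; the predicate
  "`e * x ∈ A` and `d = e * x * y`" separates `d`. A proper subvariety satisfies an identity
  `x ^ m = x ^ n` with `m < n`, since otherwise it contains a free cyclic monoid and hence all free
  commutative monoids. Its finitely generated members are therefore finite.

* If the variety is not inverse, it has a member `M` with some `a` that is not a multiple of
  `a * a`; then `a ^ k = a` forces `k = 1`. Inside a power of `M` indexed by the nodes of the
  infinite binary tree, functions `k` to `ℕ` are encoded as `fun w ↦ a ^ k w`. The cone below a node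
  is the union of the node and the cones below its two children, and this is a zigzag that puts the
  cone in the dominion of the nodes and the unions of a node with one child cone. An Euler
  characteristic (`treeSum`) equal to `-1` on cones and `1` on nodes is nonnegative on that
  submonoid, so the cones do not belong to it, and a nonsurjective epimorphism results.

* In the variety of all commutative monoids, `ℕ → ℤ` is an epimorphism.
-/

namespace CommMonVariety

open Filter

/-! ### Inverse commutative monoids -/

/-- Inverses are unique in a commutative monoid, so only regularity of the elements matters. -/
lemma isInverseMonoid_iff {A : Type u} [CommMonoid A] :
    IsInverseMonoid A ↔ ∀ a : A, a * a ∣ a := by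
  constructor
  · intro h a
    obtain ⟨b, ⟨hb, -⟩, -⟩ := h a
    exact ⟨b, by rw [mul_right_comm]; exact hb⟩
  · intro h a
    obtain ⟨t, ht⟩ := h a
    have e : a = a * (a * t * t) * a := by
      calc a = a * a * t := ht
        _ = a * a * t * a * t := by rw [← ht]; exact ht
        _ = a * (a * t * t) * a := by ac_rfl
    have hb : a * t * t = a * t * t * a * (a * t * t) := by
      calc a * t * t = a * (a * t * t) * a * t * t := by rw [← e]
        _ = a * t * t * a * (a * t * t) := by ac_rfl
    refine ⟨a * t * t, ⟨e, hb⟩, ?_⟩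
    rintro c ⟨hac, hca⟩
    generalize a * t * t = b at e hb
    calc c = c * (a * b * a) * c := by rw [← e]; exact hca
      _ = c * a * c * (a * b) := by ac_rfl
      _ = b * a * b * (a * c) := by rw [← hca, ← hb]; ac_rfl
      _ = b * (a * c * a) * b := by ac_rfl
      _ = b := by rw [← hac]; exact hb.symm

/-! ### Varieties and separating pairs of homomorphisms -/

namespace IsVariety

variable {K : Set CommMonCat.{u}}

lemma prod_self (hK : IsVariety K) {B : CommMonCat.{u}} (hB : B ∈ K) :
    CommMonCat.of (B × B) ∈ K := by
  refine hK.homImage _ _ (hK.product (ULift.{u} Bool) (fun _ => B) fun _ => hB)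
    (MonoidHom.prod (Pi.evalMonoidHom (fun _ : ULift.{u} Bool => (B : Type u)) ⟨true⟩)
      (Pi.evalMonoidHom (fun _ : ULift.{u} Bool => (B : Type u)) ⟨false⟩)) ?_
  rintro ⟨x, y⟩
  exact ⟨fun i => cond i.down x y, rfl⟩

/-- The two homomorphisms are the coordinate embeddings of `B` in the quotient of `B × B` by the
syntactic congruence of `P`, the largest congruence for which `P` is a union of classes. -/
lemma exists_separating (hK : IsVariety K) {B : CommMonCat.{u}} (hB : B ∈ K) (A : Set B)
    (P : B → B → Prop) (hP : ∀ s ∈ A, ∀ x y, P (x * s) y ↔ P x (s * y))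
    {d : B} (h₁ : P 1 d) (h₂ : ¬ P d 1) :
    ∃ C ∈ K, ∃ g h : B →* C, Set.EqOn g h A ∧ g d ≠ h d := by
  let c : Con (B × B) :=
    { r := fun p q => ∀ z : B × B, P (p.1 * z.1) (p.2 * z.2) ↔ P (q.1 * z.1) (q.2 * z.2)
      iseqv :=
        ⟨fun _ _ => Iff.rfl, fun h z => (h z).symm, fun h h' z => (h z).trans (h' z)⟩
      mul' := by
        intro p q p' q' h h' z
        have e₁ := h (p' * z)
        have e₂ := h' (q * z)
        simp only [Prod.fst_mul, Prod.snd_mul] at e₁ e₂ ⊢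
        rw [mul_assoc, mul_assoc, e₁, mul_left_comm, mul_left_comm q.2, e₂]
        rw [mul_left_comm, mul_left_comm q'.2, mul_assoc, mul_assoc] }
  refine ⟨CommMonCat.of c.Quotient, hK.homImage _ _ (hK.prod_self hB) c.mk' Con.mk'_surjective,
    c.mk'.comp (MonoidHom.inl B B), c.mk'.comp (MonoidHom.inr B B), ?_, ?_⟩
  · intro s hs
    refine (Con.eq c).2 fun z => ?_
    simpa [mul_comm s] using hP s hs z.1 z.2
  · intro h
    have := (Con.eq c).1 h 1
    simp only [MonoidHom.inl_apply, MonoidHom.inr_apply, Prod.fst_one, Prod.snd_one,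
      mul_one] at this
    exact h₂ (this.2 h₁)

lemma mrange_mem (hK : IsVariety K) {A B : CommMonCat.{u}} (hA : A ∈ K) (f : A →* B) :
    CommMonCat.of (MonoidHom.mrange f) ∈ K :=
  hK.homImage _ _ hA f.mrangeRestrict f.mrangeRestrict_surjective

lemma hasStrongES_of_isInverse (hK : IsVariety K) (hI : IsInverse K) : HasStrongES K := by
  intro A hA B hB f d hd
  have hinv : ∀ s ∈ MonoidHom.mrange f, ∃ t ∈ MonoidHom.mrange f, s = s * t * s := by
    intro s hs
    obtain ⟨t, ⟨ht, -⟩, -⟩ := hI _ (hK.mrange_mem hA f) ⟨s, hs⟩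
    exact ⟨t, t.2, congrArg Subtype.val ht⟩
  refine hK.exists_separating hB (Set.range f)
    (fun x y => ∃ a ∈ MonoidHom.mrange f, ∃ e ∈ MonoidHom.mrange f,
      e * e = e ∧ d = a * y ∧ a = e * x) ?_ ?_ ?_
  · intro s hs x y
    constructor
    · rintro ⟨a, ha, e, he, hee, hd, hx⟩
      obtain ⟨t, htA, ht⟩ := hinv s hs
      refine ⟨a * t, mul_mem ha htA, e * (s * t), mul_mem he (mul_mem hs htA), ?_, ?_, ?_⟩
      · calc e * (s * t) * (e * (s * t)) = (e * e) * ((s * t * s) * t) := by ac_rfl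
          _ = e * (s * t) := by rw [← ht, hee]
      · calc d = e * (x * s) * y := by rw [hd, hx]
          _ = e * (x * (s * t * s)) * y := by rw [← ht]
          _ = e * (x * s) * t * (s * y) := by ac_rfl
          _ = a * t * (s * y) := by rw [hx]
      · rw [hx]; ac_rfl
    · rintro ⟨a, ha, e, he, hee, hd, hx⟩
      exact ⟨a * s, mul_mem ha hs, e, he, hee, by rw [hd, mul_assoc], by rw [hx, mul_assoc]⟩
  · exact ⟨1, one_mem _, 1, one_mem _, by simp⟩
  · rintro ⟨a, ha, -, -, -, h, -⟩
    rw [mul_one] at h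
    exact hd (h ▸ ha)

end IsVariety

lemma HasStrongES.hasES {K : Set CommMonCat.{u}} (h : HasStrongES K) : HasES K := by
  intro A hA B hB f hf b
  by_contra hb
  obtain ⟨C, hC, g, k, hgk, hne⟩ := h A hA B hB f b hb
  exact hne (DFunLike.congr_fun (hf C hC g k (MonoidHom.ext fun a => hgk ⟨a, rfl⟩)) b)

/-! ### The Euler characteristic on the binary tree -/

/-- The sum of `k` over the nodes at depth less than `n` below `w` in the binary tree, minus the
sum of `k` over the nodes at depth exactly `n` below `w`. A node is a word, and its
children are obtained by prepending a letter. -/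
def treeSum (k : List Bool → ℕ) : ℕ → List Bool → ℤ
  | 0, w => -(k w : ℤ)
  | n + 1, w => k w + treeSum k n (true :: w) + treeSum k n (false :: w)

lemma treeSum_zero (n : ℕ) (w : List Bool) : treeSum 0 n w = 0 := by
  induction n generalizing w with
  | zero => simp [treeSum]
  | succ n ih => simp [treeSum, ih]

lemma treeSum_add (k l : List Bool → ℕ) (n : ℕ) (w : List Bool) :
    treeSum (k + l) n w = treeSum k n w + treeSum l n w := by
  induction n generalizing w with
  | zero => simp [treeSum]; ring
  | succ n ih => simp [treeSum, ih]; ring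

/-- The indicator function of the set of words that end in `u`, that is, of the node `u` and its
descendants. -/
def cone (u w : List Bool) : ℕ := if u <:+ w then 1 else 0

lemma eq_of_cons_suffix {b c : Bool} {u w : List Bool} (hb : b :: u <:+ w) (hc : c :: u <:+ w) :
    b = c := by
  have := (List.suffix_of_suffix_length_le hb hc (by simp)).eq_of_length (by simp)
  simpa using this

lemma cone_eq_add (u : List Bool) :
    cone u = cone (true :: u) + Pi.single u 1 + cone (false :: u) := by
  funext w
  by_cases hw : w = u
  · subst hw
    have h (b : Bool) : ¬ b :: w <:+ w := fun h => by simpa using h.length_le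
    simp [cone, h]
  · by_cases hu : u <:+ w
    · obtain ⟨v, rfl⟩ := hu
      rcases List.eq_nil_or_concat v with rfl | ⟨v, b, rfl⟩
      · simp at hw
      · have hb : b :: u <:+ v ++ b :: u := List.suffix_append _ _
        have hn : ∀ c, c :: u <:+ v ++ b :: u ↔ c = b :=
          fun c => ⟨fun h => eq_of_cons_suffix h hb, fun h => h ▸ hb⟩
        have hu : u <:+ v ++ b :: u := (List.suffix_cons b u).trans hb
        have hw' : v ++ b :: u ≠ u := by simpa using hw
        cases b <;> simp [cone, hn, hu, hw']
    · have h (b : Bool) : ¬ b :: u <:+ w := fun h => hu ((List.suffix_cons b u).trans h)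
      simp [cone, hu, h, hw]

lemma treeSum_eq_zero {k : List Bool → ℕ} {w : List Bool} (h : ∀ v, w <:+ v → k v = 0) (n : ℕ) :
    treeSum k n w = 0 := by
  induction n generalizing w with
  | zero => simp [treeSum, h w List.suffix_rfl]
  | succ n ih =>
    have hc (b : Bool) : treeSum k n (b :: w) = 0 :=
      ih fun v hv => h v ((List.suffix_cons b w).trans hv)
    simp [treeSum, h w List.suffix_rfl, hc]

/-- A function supported on the cone of `u` has the same Euler characteristic at the root as at `u`,
after a shift of the depth by the length of `u`. -/
lemma treeSum_add_length {k : List Bool → ℕ} {u : List Bool} (h : ∀ v, ¬ u <:+ v → k v = 0)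
    (n : ℕ) : treeSum k (n + u.length) [] = treeSum k n u := by
  induction u generalizing n with
  | nil => rfl
  | cons b u ih =>
    have hu : k u = 0 := h u fun h' => by simpa using h'.length_le
    have hb (c : Bool) (hc : c ≠ b) : treeSum k n (c :: u) = 0 :=
      treeSum_eq_zero (fun v hv => h v fun hv' => hc (eq_of_cons_suffix hv hv')) n
    have := ih (fun v hv => h v fun h' => hv ((List.suffix_cons b u).trans h')) (n + 1)
    rw [List.length_cons, ← add_assoc, add_right_comm, this]
    cases b <;> simp [treeSum, hu, hb]

lemma treeSum_cone_of_suffix {u w : List Bool} (h : u <:+ w) (n : ℕ) :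
    treeSum (cone u) n w = -1 := by
  induction n generalizing w with
  | zero => simp [treeSum, cone, h]
  | succ n ih =>
    have hc (b : Bool) : treeSum (cone u) n (b :: w) = -1 := ih (h.trans (List.suffix_cons b w))
    simp [treeSum, hc, cone, h]

lemma eventually_treeSum_cone (u : List Bool) : ∀ᶠ n in atTop, treeSum (cone u) n [] = -1 := by
  filter_upwards [eventually_ge_atTop u.length] with n hn
  obtain ⟨m, rfl⟩ := Nat.exists_eq_add_of_le' hn
  rw [treeSum_add_length (k := cone u) fun v hv => if_neg hv]
  exact treeSum_cone_of_suffix List.suffix_rfl m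

lemma eventually_treeSum_single (u : List Bool) :
    ∀ᶠ n in atTop, treeSum (Pi.single u 1) n [] = 1 := by
  filter_upwards [eventually_treeSum_cone u, eventually_treeSum_cone (true :: u),
    eventually_treeSum_cone (false :: u)] with n h h₁ h₀
  rw [cone_eq_add, treeSum_add, treeSum_add] at h
  linarith

/-- The functions on the binary tree whose Euler characteristic is eventually nonnegative. -/
def nonnegTree : AddSubmonoid (List Bool → ℕ) where
  carrier := {k | ∀ᶠ n in atTop, 0 ≤ treeSum k n []}
  zero_mem' := by simp [treeSum_zero]
  add_mem' := by
    intro k l hk hl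
    filter_upwards [hk, hl] with n h₁ h₂
    rw [treeSum_add]
    exact add_nonneg h₁ h₂

lemma single_mem_nonnegTree (u : List Bool) : Pi.single u 1 ∈ nonnegTree := by
  filter_upwards [eventually_treeSum_single u] with n h
  simp [h]

lemma cone_add_single_mem_nonnegTree (b : Bool) (u : List Bool) :
    cone (b :: u) + Pi.single u 1 ∈ nonnegTree := by
  filter_upwards [eventually_treeSum_single u, eventually_treeSum_cone (b :: u)] with n h h'
  simp [treeSum_add, h, h']

lemma cone_notMem_nonnegTree (u : List Bool) : cone u ∉ nonnegTree := by
  intro h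
  obtain ⟨n, h₁, h₂⟩ := (Filter.Eventually.and h (eventually_treeSum_cone u)).exists
  omega

/-! ### Varieties that are not inverse -/

/-- The homomorphism that sends a function `k` on the binary tree to the family `a ^ k w`. The
index type is lifted to the universe of the variety. -/
def treePow {M : Type u} [CommMonoid M] (a : M) :
    Multiplicative (List Bool → ℕ) →* (ULift.{u} (List Bool) → M) where
  toFun k w := a ^ k.toAdd w.down
  map_one' := by ext; simp
  map_mul' k l := by ext; simp [pow_add]

lemma eq_one_of_pow_eq_self {M : Type u} [CommMonoid M] {a : M} (ha : ¬ a * a ∣ a) {k : ℕ}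
    (h : a ^ k = a) : k = 1 := by
  match k with
  | 0 =>
    rw [pow_zero] at h
    exact absurd (by simp [← h]) ha
  | 1 => rfl
  | k + 2 => exact absurd ⟨a ^ k, by rw [← pow_two, ← pow_add, add_comm, h]⟩ ha

/-- The inclusion of the image of `nonnegTree` in the submonoid that the cones generate together
with it is a nonsurjective epimorphism, for any variety that contains a nonregular element `a`. -/
lemma IsVariety.isInverse_of_hasES {K : Set CommMonCat.{u}} (hK : IsVariety K) (hES : HasES K) :
    IsInverse K := by
  intro M hM
  rw [isInverseMonoid_iff]
  by_contra! ⟨a, ha⟩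
  let Φ := treePow a
  let A := (AddSubmonoid.toSubmonoid nonnegTree).map Φ
  let B := A ⊔ Submonoid.closure (Set.range fun u => Φ (.ofAdd (cone u)))
  have hAB : A ≤ B := le_sup_left
  have hcone (u) : Φ (.ofAdd (cone u)) ∈ B :=
    le_sup_right (a := A) (Submonoid.subset_closure ⟨u, rfl⟩)
  have hP := hK.product (ULift.{u} (List Bool)) (fun _ => M) fun _ => hM
  have hsurj := hES (.of A) (hK.subalgebra _ hP A) (.of B) (hK.subalgebra _ hP B)
    (Submonoid.inclusion hAB) ?_
  · obtain ⟨⟨_, k, hk, rfl⟩, h⟩ := hsurj ⟨_, hcone []⟩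
    have h' : Φ k = Φ (.ofAdd (cone [])) := congrArg Subtype.val h
    -- Every value of `Φ k` is `a`, so every exponent is `1`.
    have : k.toAdd = cone [] := by
      funext w
      have hw := congrFun h' ⟨w⟩
      have e : cone [] w = 1 := by simp [cone]
      rw [e]
      refine eq_one_of_pow_eq_self ha (hw.trans ?_)
      change a ^ cone [] w = a
      rw [e, pow_one]
    exact cone_notMem_nonnegTree [] (this ▸ hk)
  · intro C hC g h hgh
    have hA (p) (hp : p ∈ A) : g ⟨p, hAB hp⟩ = h ⟨p, hAB hp⟩ := DFunLike.congr_fun hgh ⟨p, hp⟩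
    have hle : B ≤ (MonoidHom.eqLocusM g h).map B.subtype := by
      refine sup_le (fun p hp => ⟨⟨p, hAB hp⟩, hA p hp, rfl⟩) (Submonoid.closure_le.2 ?_)
      rintro _ ⟨u, rfl⟩
      refine ⟨⟨_, hcone u⟩, ?_, rfl⟩
      have hs : Φ (.ofAdd (Pi.single u 1)) ∈ A := ⟨_, single_mem_nonnegTree u, rfl⟩
      have hcs (b : Bool) : Φ (.ofAdd (cone (b :: u))) * Φ (.ofAdd (Pi.single u 1)) ∈ A :=
        ⟨_, cone_add_single_mem_nonnegTree b u, map_mul Φ _ _⟩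
      let x (b : Bool) : B := ⟨_, hcone (b :: u)⟩
      let s : B := ⟨_, hAB hs⟩
      have hu : (⟨_, hcone u⟩ : B) = x true * s * x false :=
        Subtype.ext ((congrArg (fun k => Φ (.ofAdd k)) (cone_eq_add u)).trans
          ((map_mul Φ _ _).trans (congrArg (· * _) (map_mul Φ _ _))))
      have es : g s = h s := hA _ hs
      have ex (b : Bool) : g (x b * s) = h (x b * s) := hA _ (hcs b)
      change g ⟨_, hcone u⟩ = h ⟨_, hcone u⟩
      rw [hu]
      -- Zigzag: the factor `s` is passed between the two sides.
      calc g (x true * s * x false) = h (x true * s) * g (x false) := by rw [map_mul, ex]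
        _ = h (x true) * g (x false * s) := by rw [map_mul, ← es, map_mul]; ac_rfl
        _ = h (x true * s * x false) := by rw [ex, ← map_mul]; congr 1; ac_rfl
    ext ⟨p, hp⟩
    obtain ⟨q, hq, rfl⟩ := hle hp
    exact hq

/-! ### Proper subvarieties -/

/-- A variety with an element of infinite order, all of whose powers are distinct, is everything. -/
lemma IsVariety.eq_CM {K : Set CommMonCat.{u}} (hK : IsVariety K) {M : CommMonCat.{u}}
    (hM : M ∈ K) {x : M} (hx : Function.Injective fun n : ℕ => x ^ n) : K = CM := by
  refine Set.eq_univ_of_forall fun A => ?_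
  -- The free commutative monoid on the underlying set of `A` embeds in a power of `M`.
  let Θ : Multiplicative (A →₀ ℕ) →* (A → M) :=
    { toFun := fun k a => x ^ k.toAdd a
      map_one' := by ext; simp
      map_mul' := fun k l => by ext; simp [pow_add] }
  have hΘ : Function.Injective Θ := fun k l h =>
    Multiplicative.toAdd.injective (Finsupp.ext fun a => hx (congrFun h a))
  let E : Multiplicative (A →₀ ℕ) ≃* MonoidHom.mrange Θ :=
    MulEquiv.ofBijective Θ.mrangeRestrict
      ⟨fun k l h => hΘ (congrArg Subtype.val h), Θ.mrangeRestrict_surjective⟩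
  let π : Multiplicative (A →₀ ℕ) →* A :=
    { toFun := fun k => k.toAdd.prod fun a n => a ^ n
      map_one' := Finsupp.prod_zero_index
      map_mul' := fun k l => Finsupp.prod_add_index' (fun a => pow_zero a) fun a => pow_add a }
  have hπ : Function.Surjective π := fun a => ⟨.ofAdd (Finsupp.single a 1), by simp [π]⟩
  exact hK.homImage _ _ (hK.subalgebra _ (hK.product A (fun _ => M) fun _ => hM)
    (MonoidHom.mrange Θ)) (π.comp E.symm.toMonoidHom) (hπ.comp E.symm.surjective)

lemma IsVariety.exists_pow_eq_pow {K : Set CommMonCat.{u}} (hK : IsVariety K) (hne : K ≠ CM) :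
    ∃ m n : ℕ, m < n ∧ ∀ M ∈ K, ∀ x : M, x ^ m = x ^ n := by
  by_contra! h
  choose M hM x hx using fun (p : {p : ℕ × ℕ // p.1 < p.2}) => h p.1.1 p.1.2 p.2
  refine hne (hK.eq_CM (hK.product (ULift.{u} {p : ℕ × ℕ // p.1 < p.2}) (fun p => M p.down)
    fun p => hM p.down) (x := fun p => x p.down) ?_)
  have aux : ∀ m n : ℕ, m < n → (fun p : ULift.{u} {p : ℕ × ℕ // p.1 < p.2} => x p.down) ^ m ≠
      (fun p : ULift.{u} {p : ℕ × ℕ // p.1 < p.2} => x p.down) ^ n :=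
    fun m n hmn e => hx ⟨(m, n), hmn⟩ (congrFun e ⟨⟨(m, n), hmn⟩⟩)
  intro m n e
  by_contra hmn
  rcases Nat.lt_or_gt_of_ne hmn with hlt | hlt
  · exact aux m n hlt e
  · exact aux n m hlt e.symm

lemma exists_lt_pow_eq_pow {B : Type*} [Monoid B] {x : B} {m n : ℕ} (hmn : m < n)
    (h : x ^ m = x ^ n) (k : ℕ) : ∃ j < n, x ^ k = x ^ j := by
  induction k with
  | zero => exact ⟨0, by omega, rfl⟩
  | succ k ih =>
    obtain ⟨j, hj, e⟩ := ih
    rw [pow_succ, e, ← pow_succ]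
    rcases Nat.lt_or_ge (j + 1) n with hj' | hj'
    · exact ⟨_, hj', rfl⟩
    · exact ⟨m, hmn, by rw [h]; congr 1; omega⟩

lemma finite_of_fg {B : Type*} [CommMonoid B] (hB : Monoid.FG B) {m n : ℕ} (hmn : m < n)
    (h : ∀ x : B, x ^ m = x ^ n) : Finite B := by
  classical
  obtain ⟨S, hS⟩ := Monoid.fg_def.1 hB
  have key (T : Finset B) : (Submonoid.closure (T : Set B) : Set B).Finite := by
    induction T using Finset.induction_on with
    | empty => simp
    | insert a T _ ih =>
      refine (Set.Finite.image2 (fun j b => a ^ j * b) (Set.finite_Iio n) ih).subset ?_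
      intro b hb
      rw [Finset.coe_insert, Set.insert_eq, Submonoid.closure_union, SetLike.mem_coe,
        Submonoid.mem_sup] at hb
      obtain ⟨y, hy, z, hz, rfl⟩ := hb
      obtain ⟨k, rfl⟩ := Submonoid.mem_closure_singleton.1 hy
      obtain ⟨j, hj, e⟩ := exists_lt_pow_eq_pow hmn (h a) k
      exact ⟨j, hj, z, hz, by simp only [e]⟩
  have := key S
  rw [hS] at this
  exact Set.finite_univ_iff.1 this

lemma exists_pow_succ_idempotent {B : Type*} [Monoid B] [Finite B] (x : B) :
    ∃ N : ℕ, x ^ (N + 1) * x ^ (N + 1) = x ^ (N + 1) := by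
  obtain ⟨m, p, hp, e⟩ : ∃ m p : ℕ, 0 < p ∧ x ^ (m + p) = x ^ m := by
    obtain ⟨m, n, hne, e⟩ := Finite.exists_ne_map_eq_of_infinite fun n : ℕ => x ^ n
    rcases Nat.lt_or_gt_of_ne hne with h | h
    · exact ⟨m, n - m, by omega, by rw [Nat.add_sub_cancel' h.le]; exact e.symm⟩
    · exact ⟨n, m - n, by omega, by rw [Nat.add_sub_cancel' h.le]; exact e⟩
  have hper (k j : ℕ) (hk : m ≤ k) : x ^ (k + j * p) = x ^ k := by
    obtain ⟨i, rfl⟩ := Nat.exists_eq_add_of_le hk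
    induction j with
    | zero => simp
    | succ j ih =>
      calc x ^ (m + i + (j + 1) * p) = x ^ (m + p) * x ^ (i + j * p) := by
            rw [← pow_add]; congr 1; ring
        _ = x ^ (m + i + j * p) := by rw [e, ← pow_add, add_assoc]
        _ = x ^ (m + i) := ih
  -- The exponent is a positive multiple of the period `p` and at least the index `m`.
  obtain ⟨N, hN⟩ := Nat.exists_eq_succ_of_ne_zero (Nat.mul_pos m.succ_pos hp).ne'
  refine ⟨N, ?_⟩
  rw [← Nat.succ_eq_add_one, ← hN, ← pow_add]
  exact hper _ _ (by nlinarith)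

/-- In a finite commutative monoid, an element of the complement of a submonoid that is minimal for
divisibility lies outside the dominion of the submonoid. -/
lemma IsVariety.exists_separating_of_finite {K : Set CommMonCat.{u}} (hK : IsVariety K)
    {B : CommMonCat.{u}} (hB : B ∈ K) [Finite B] (A : Submonoid B) {d : B} (hd : d ∉ A)
    (hdvd : ∀ y ∉ A, y ∣ d → d ∣ y) :
    ∃ C ∈ K, ∃ g h : B →* C, Set.EqOn g h A ∧ g d ≠ h d := by
  classical
  have := Fintype.ofFinite B
  -- The idempotents of `A` that fix `d`, and their product, the least one.
  let E : Submonoid B :=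
    { carrier := {e | e ∈ A ∧ e * e = e ∧ e * d = d}
      one_mem' := ⟨one_mem A, one_mul 1, one_mul d⟩
      mul_mem' := by
        rintro e f ⟨h₁, h₂, h₃⟩ ⟨k₁, k₂, k₃⟩
        exact ⟨mul_mem h₁ k₁, by rw [mul_mul_mul_comm, h₂, k₂], by rw [mul_assoc, k₃, h₃]⟩ }
  let e : B := ∏ f ∈ Finset.univ.filter (· ∈ E), f
  obtain ⟨heA, -, hed⟩ : e ∈ E := prod_mem fun f hf => (Finset.mem_filter.1 hf).2
  have hmin (f) (hf : f ∈ E) : e * f = e := by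
    have hf' : f ∈ Finset.univ.filter (· ∈ E) := by simpa using hf
    change (∏ f ∈ Finset.univ.filter (· ∈ E), f) * f = ∏ f ∈ Finset.univ.filter (· ∈ E), f
    rw [← Finset.mul_prod_erase _ _ hf', mul_right_comm, hf.2.1]
  refine hK.exists_separating hB A (fun x y => e * x ∈ A ∧ d = e * x * y) ?_ ?_ ?_
  · intro s hs x y
    constructor
    · rintro ⟨hx, hxy⟩
      refine ⟨?_, by rw [hxy]; ac_rfl⟩
      have hy : y ∉ A := fun hy => hd (hxy ▸ mul_mem hx hy)
      -- By minimality of `d`, `y` is a multiple of `d`, so `s` acts invertibly on `d`.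
      obtain ⟨t, ht⟩ := hdvd y hy ⟨e * (x * s), by rw [mul_comm]; exact hxy⟩
      have hsd : d = s * (e * x * t) * d := by
        conv_lhs => rw [hxy, ht]
        ac_rfl
      obtain ⟨N, hN⟩ := exists_pow_succ_idempotent s
      have hpow (k : ℕ) : d = s ^ k * (e * x * t) ^ k * d := by
        induction k with
        | zero => simp
        | succ k ih =>
          rw [← mul_pow] at ih ⊢
          rw [pow_succ, mul_assoc, ← hsd, ← ih]
      have hfix : s ^ (N + 1) * d = d := by
        conv_lhs => rw [hpow (N + 1)]
        rw [← mul_assoc, ← mul_assoc, hN, ← hpow]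
      have hE : s ^ (N + 1) ∈ E := ⟨pow_mem hs _, hN, hfix⟩
      have : e * x = e * (x * s) * s ^ N := by
        conv_lhs => rw [← hmin _ hE, pow_succ]
        ac_rfl
      rw [this]
      exact mul_mem hx (pow_mem hs N)
    · rintro ⟨hx, hxy⟩
      exact ⟨by rw [← mul_assoc]; exact mul_mem hx hs, by rw [hxy]; ac_rfl⟩
  · simp [heA, hed]
  · rintro ⟨h, h'⟩
    rw [mul_one] at h'
    exact hd (h' ▸ h)

lemma IsVariety.hasWeakES {K : Set CommMonCat.{u}} (hK : IsVariety K) (hne : K ≠ CM) :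
    HasWeakES K := by
  intro A hA B hB _ hBfg f hf
  obtain ⟨m, n, hmn, hpow⟩ := hK.exists_pow_eq_pow hne
  have : Finite B := finite_of_fg hBfg hmn (hpow B hB)
  by_contra hsurj
  obtain ⟨b, hb⟩ := not_forall.1 hsurj
  -- An element with an inclusion-minimal set of divisors is minimal for divisibility.
  obtain ⟨d, hd, hdmin⟩ := (Set.toFinite {b : B | b ∉ MonoidHom.mrange f}).exists_minimalFor
    (fun b => {y : B | y ∣ b}) _ ⟨b, hb⟩
  obtain ⟨C, hC, g, h, hgh, hne⟩ := hK.exists_separating_of_finite hB (MonoidHom.mrange f) hd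
    fun y hy hyd => hdmin hy (fun z hz => hz.trans hyd) (dvd_refl d)
  exact hne (DFunLike.congr_fun (hf C hC g h (MonoidHom.ext fun a => hgh ⟨a, rfl⟩)) d)

/-! ### The variety of all commutative monoids -/

lemma not_hasWeakES_CM : ¬ HasWeakES (CM : Set CommMonCat.{u}) := by
  intro h
  let f : Multiplicative ℕ →* Multiplicative ℤ :=
    AddMonoidHom.toMultiplicative (Nat.castAddMonoidHom ℤ)
  let eℕ : ULift.{u} (Multiplicative ℕ) ≃* Multiplicative ℕ := MulEquiv.ulift
  let eℤ : ULift.{u} (Multiplicative ℤ) ≃* Multiplicative ℤ := MulEquiv.ulift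
  have hℕ : Monoid.FG (Multiplicative ℕ) := inferInstance
  have hℤ : Monoid.FG (Multiplicative ℤ) := inferInstance
  have hsurj := h (.of (ULift.{u} (Multiplicative ℕ))) trivial
    (.of (ULift.{u} (Multiplicative ℤ))) trivial
    (Monoid.fg_of_surjective eℕ.symm.toMonoidHom eℕ.symm.surjective)
    (Monoid.fg_of_surjective eℤ.symm.toMonoidHom eℤ.symm.surjective)
    (eℤ.symm.toMonoidHom.comp (f.comp eℕ.toMonoidHom)) ?_
  · obtain ⟨⟨n⟩, hn⟩ := hsurj ⟨.ofAdd (-1)⟩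
    have hn' : ((n.toAdd : ℕ) : ℤ) = -1 :=
      congrArg (fun z : ULift.{u} (Multiplicative ℤ) => z.down.toAdd) hn
    omega
  · intro C _ g k hgk
    have key : g.comp eℤ.symm.toMonoidHom = k.comp eℤ.symm.toMonoidHom :=
      MonoidHom.ext_mint (DFunLike.congr_fun hgk ⟨.ofAdd 1⟩)
    ext ⟨z⟩
    exact DFunLike.congr_fun key z

end CommMonVariety

theorem mainTheorem7 :
    (∀ K : Set CommMonCat.{u}, CommMonVariety.IsVariety K →
      (CommMonVariety.HasES K ↔ CommMonVariety.IsInverse K) ∧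
      (CommMonVariety.HasStrongES K ↔ CommMonVariety.IsInverse K)) ∧
    (∀ K : Set CommMonCat.{u}, CommMonVariety.IsVariety K →
      K ≠ CommMonVariety.CM → CommMonVariety.HasWeakES K) ∧
    ¬ CommMonVariety.HasWeakES (CommMonVariety.CM : Set CommMonCat.{u}) :=
  ⟨fun _ hK =>
    ⟨⟨hK.isInverse_of_hasES, fun hI => (hK.hasStrongES_of_isInverse hI).hasES⟩,
      ⟨fun h => hK.isInverse_of_hasES h.hasES, hK.hasStrongES_of_isInverse⟩⟩,
    fun _ hK hne => hK.hasWeakES hne, CommMonVariety.not_hasWeakES_CM⟩
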